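/- Let $\mathbb{T}=\mathbb{R}/\mathbb{Z}$ and identify $\mathbb{F}_2$ with the subgroup $\{0,1/2\}$ of $\mathbb{T}$ via $0\mapsto 0$, $1\mapsto 1/2$. A non-classical polynomial in $n$ variables is a function $P:\mathbb{F}_2^n\to\mathbb{T}$ of the form $$P(x_1,\dots,x_n)=\alpha+\sum_{\emptyset\ne S\subseteq\{1,\dots,n\},\ k\ge 1}\frac{c_{S,k}\prod_{i\in S}x_i}{2^k} \pmod 1,$$ where $\alpha\in\mathbb{T}$ (the shift), $c_{S,k}\in\{0,1\}$, only finitely many $c_{S,k}$ are nonzero, and each $x_i$ is read as an integer in $\{0,1\}$. Its degree is the largest $|S|+k-1$, and its depth the largest $k$, over all $(S,k)$ with $c_{S,k}\neq 0$ (both are $0$ if there are none). It is classical if its depth is at most $1$ and $\alpha\in\{0,1/2\}$; classical polynomials are exactly the $\{0,1/2\}$-valued functions given by polynomials over $\mathbb{F}_2$. For $t\ge 1$ let $S_t:\mathbb{F}_2^n\to\{0,1/2\}$ be the Boolean function given by the elementary symmetric polynomial of degree $t$ over $\mathbb{F}_2$ in $n$ variables. Theorem. Fix any integer $\ell\ge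 4$. Then there is an integer $d\ge 1$, independent of $n$, such that the following two statements hold. 1. There is a function $\varepsilon:\mathbb{N}\to\mathbb{R}$ with $\varepsilon(n)\to 0$ as $n\to\infty$ such that, for every $n\ge 1$ and every classical polynomial $P$ in $n$ variables of degree at most $d$, $$\Pr_{x\sim\mathbb{F}_2^n}[S_{2^\ell}(x)=P(x)]\le \tfrac12+\varepsilon(n).$$ 2. There is a constant $c>0$ such that, for all sufficiently large $n$, there is a non-classical polynomial $P'$ in $n$ variables of degree at most $d$, whose shift is of the form $A/2^{k}$ with $k$ the depth of $P'$ and $A\in\{0,\dots,2^k-1\}$, satisfying $$\Pr_{x\sim\mathbb{F}_2^n}[S_{2^\ell}(x)=P'(x)]\ge \tfrac12+c.$$ Here $x$ is uniformly distributed over $\mathbb{F}_2^n$. -/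

import Mathlib

open Filter Topology

noncomputable section

/-- The agreement of two functions on a finite domain: the fraction of inputs on which they
coincide. -/
def agr {D R : Type*} [Fintype D] (F G : D → R) : ℝ :=
  open Classical in
  ((Finset.univ.filter fun x => F x = G x).card : ℝ) / (Fintype.card D : ℝ)

/-- The identification of `𝔽₂` with the subgroup `{0, 1/2}` of the torus `ℝ/ℤ`. -/
def toTorus (a : ZMod 2) : UnitAddCircle :=
  (((a.val : ℝ) / 2 : ℝ) : UnitAddCircle)

/-- The elementary symmetric polynomial of degree `t` over `𝔽₂` in `n` variables, as a Boolean
function with values in `{0, 1/2} ⊆ ℝ/ℤ`. -/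
def elemSym (n t : ℕ) (x : Fin n → ZMod 2) : UnitAddCircle :=
  toTorus (MvPolynomial.eval x (MvPolynomial.esymm (Fin n) (ZMod 2) t))

/-- A non-classical polynomial in `n` variables over `𝔽₂`, in the normal form
`α + ∑ c_{S,k} (∏_{i ∈ S} x_i) / 2 ^ k (mod 1)`, over nonempty sets `S` of variables and `k ≥ 1`,
with `c_{S,k} ∈ {0, 1}`. The set `S` collects the variables of exponent `1`, and `terms` is the
finite set of pairs `(S, k)` with `c_{S,k} = 1`. -/
structure NonclassicalPolynomial (n : ℕ) where
  shift : UnitAddCircle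
  terms : Finset (Finset (Fin n) × ℕ)
  nonempty_of_mem : ∀ t ∈ terms, t.1.Nonempty
  one_le_of_mem : ∀ t ∈ terms, 1 ≤ t.2

namespace NonclassicalPolynomial

/-- The function `𝔽₂ⁿ → ℝ/ℤ` given by a non-classical polynomial; the coordinates are lifted to
`{0, 1} ⊆ ℝ`. -/
def eval {n : ℕ} (P : NonclassicalPolynomial n) (x : Fin n → ZMod 2) : UnitAddCircle :=
  P.shift + ∑ t ∈ P.terms,
    (((∏ i ∈ t.1, ((x i).val : ℝ)) / 2 ^ t.2 : ℝ) : UnitAddCircle)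

/-- The degree: the largest `|S| + (k - 1)` over the terms present (`0` for constants). -/
def degree {n : ℕ} (P : NonclassicalPolynomial n) : ℕ :=
  P.terms.sup fun t => t.1.card + (t.2 - 1)

/-- The depth: the largest `k` over the terms present (`0` for constants). -/
def depth {n : ℕ} (P : NonclassicalPolynomial n) : ℕ :=
  P.terms.sup fun t => t.2

/-- The shift is `A / 2 ^ k` with `k` the depth and `A ∈ {0, …, 2 ^ k - 1}`. -/
def HasDyadicShift {n : ℕ} (P : NonclassicalPolynomial n) : Prop :=
  ∃ A : ℕ, A < 2 ^ P.depth ∧ P.shift = (((A : ℝ) / 2 ^ P.depth : ℝ) : UnitAddCircle)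

/-- Classical polynomials: shift in `{0, 1/2}` and depth at most `1` (depth `0` being the
constants `0` and `1/2`). -/
def IsClassical {n : ℕ} (P : NonclassicalPolynomial n) : Prop :=
  (P.shift = toTorus 0 ∨ P.shift = toTorus 1) ∧ P.depth ≤ 1

end NonclassicalPolynomial

end

/-!
The integer `d = 3 · 2 ^ (ℓ - 2) + 2` works; it is smaller than `2 ^ ℓ` because `ℓ ≥ 4`.

Classical polynomials (the Ramsey argument of Alon and Beigel). Adding a polynomial of degree less
than `2 ^ ℓ` to `S_{2 ^ ℓ}` does not change the coefficients of degree at least `2 ^ ℓ`, which are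
symmetric. Going down through the degrees `k < 2 ^ ℓ`, Ramsey's theorem for `k`-uniform hypergraphs
finds a large set of variables on which the coefficients of degree `k` are constant as well; fixing
the other variables arbitrarily keeps the higher coefficients symmetric and the leading one equal to
`1`. In the end a fully symmetric polynomial of degree `2 ^ ℓ` is left. By Lucas' theorem its value
at weight `w + 2 ^ ℓ` is opposite to its value at weight `w`, and the weight of a random point is
equidistributed modulo `2 ^ (ℓ + 1)`, so the bias tends to `0`.

Non-classical polynomials. With `m = ℓ - 2`, compare `S_{4 · 2 ^ m}` with `e_{3 · 2 ^ m} / 8`. By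
Kummer's theorem `C(w, 2 ^ m · k)` and `C(⌊w / 2 ^ m⌋, k)` have the same 2-adic valuation, which
reduces agreement to `4 C(u, 4) ≡ C(u, 3)` modulo `8` for `u = ⌊w / 2 ^ m⌋`. This condition has
period `16` in `u` and holds for `9` residues, so the agreement tends to `9 / 16`.
-/

universe u

section Ramsey

open Finset

variable {α : Type u}

/-- Some `a`-subset of `V` has all its `k`-subsets satisfying `c`: a clique on `a` vertices in the
`k`-uniform hypergraph with edge set `c`. -/
def HasHyperclique (k a : ℕ) (c : Finset α → Prop) (V : Finset α) : Prop :=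
  ∃ T ⊆ V, #T = a ∧ ∀ K ⊆ T, #K = k → c K

/-- `N` bounds the Ramsey number of two-coloured `k`-uniform complete hypergraphs for cliques of
sizes `a` and `b`. -/
def IsRamseyBound (k a b N : ℕ) : Prop :=
  ∀ ⦃α : Type u⦄ (V : Finset α), N ≤ #V → ∀ c : Finset α → Prop,
    HasHyperclique k a c V ∨ HasHyperclique k b (¬c ·) V

theorem HasHyperclique.mono {k a : ℕ} {c : Finset α → Prop} {V W : Finset α}
    (h : HasHyperclique k a c V) (hVW : V ⊆ W) : HasHyperclique k a c W :=
  h.imp fun _ hT => ⟨hT.1.trans hVW, hT.2⟩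

theorem HasHyperclique.insert_of_link [DecidableEq α] {k a : ℕ} {c : Finset α → Prop}
    {V : Finset α} {v : α} (h : HasHyperclique (k + 1) a c V) (hv : v ∉ V)
    (hlink : ∀ K ⊆ V, #K = k → c (insert v K)) : HasHyperclique (k + 1) (a + 1) c (insert v V) := by
  obtain ⟨T, hTV, hTa, hT⟩ := h
  refine ⟨insert v T, insert_subset_insert v hTV,
    by rw [card_insert_of_notMem (fun hvT => hv (hTV hvT)), hTa], fun K hK hKk => ?_⟩
  by_cases hvK : v ∈ K
  · rw [← insert_erase hvK]
    exact hlink _ ((subset_insert_iff.mp hK).trans hTV)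
      (by rw [card_erase_of_mem hvK, hKk, Nat.add_sub_cancel])
  · exact hT K ((subset_insert_iff_of_notMem hvK).mp hK) hKk

theorem isRamseyBound_zero_uniformity (a b : ℕ) : IsRamseyBound.{u} 0 a b (max a b) := by
  intro α V hV c
  have hclique {c : Finset α → Prop} (hc : c ∅) {a : ℕ} (ha : a ≤ #V) :
      HasHyperclique 0 a c V := by
    obtain ⟨T, hT, hTa⟩ := exists_subset_card_eq ha
    exact ⟨T, hT, hTa, fun K _ hK => by rwa [card_eq_zero.mp hK]⟩
  by_cases hc : c ∅
  · exact Or.inl (hclique hc ((le_max_left a b).trans hV))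
  · exact Or.inr (hclique hc ((le_max_right a b).trans hV))

theorem isRamseyBound_zero_left (k b : ℕ) : IsRamseyBound.{u} (k + 1) 0 b 0 :=
  fun _ V _ _ => Or.inl ⟨∅, V.empty_subset, card_empty, fun K hK hKk => by
    simp [subset_empty.mp hK] at hKk⟩

theorem IsRamseyBound.symm {k a b N : ℕ} (h : IsRamseyBound.{u} k a b N) :
    IsRamseyBound.{u} k b a N := fun _ V hV c =>
  (h V hV (¬c ·)).symm.imp_left fun hc => by simpa only [not_not] using hc

theorem IsRamseyBound.of_link [DecidableEq α] {k a b N : ℕ}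
    (h : IsRamseyBound.{u} (k + 1) a b N) {T : Finset α} (hT : N ≤ #T) {v : α} (hv : v ∉ T)
    {c : Finset α → Prop} (hlink : ∀ K ⊆ T, #K = k → c (insert v K)) :
    HasHyperclique (k + 1) (a + 1) c (insert v T) ∨
      HasHyperclique (k + 1) b (¬c ·) (insert v T) :=
  (h T hT c).imp (·.insert_of_link hv hlink) (·.mono (subset_insert v T))

theorem IsRamseyBound.succ {k a b N₁ N₂ N : ℕ} (h₁ : IsRamseyBound.{u} (k + 1) a (b + 1) N₁)
    (h₂ : IsRamseyBound.{u} (k + 1) (a + 1) b N₂) (h : IsRamseyBound.{u} k N₁ N₂ N) :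
    IsRamseyBound.{u} (k + 1) (a + 1) (b + 1) (N + 1) := by
  classical
  intro α V hV c
  obtain ⟨v, hv⟩ : V.Nonempty := card_pos.mp (by omega)
  have hcard : N ≤ #(V.erase v) := by rw [card_erase_of_mem hv]; omega
  have hins {T : Finset α} (hT : T ⊆ V.erase v) : v ∉ T ∧ insert v T ⊆ V :=
    ⟨fun hvT => notMem_erase v V (hT hvT),
      insert_subset hv (hT.trans (V.erase_subset v))⟩
  rcases h (V.erase v) hcard (fun K => c (insert v K)) with
    ⟨T, hTV, hT, hlink⟩ | ⟨T, hTV, hT, hlink⟩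
  · exact (h₁.of_link hT.ge (hins hTV).1 hlink).imp
      (·.mono (hins hTV).2) (·.mono (hins hTV).2)
  · have := h₂.symm.of_link (c := (¬c ·)) hT.ge (hins hTV).1 hlink
    simp only [not_not] at this
    exact this.symm.imp (·.mono (hins hTV).2) (·.mono (hins hTV).2)

theorem exists_isRamseyBound (k a b : ℕ) : ∃ N, IsRamseyBound.{u} k a b N := by
  induction k generalizing a b with
  | zero => exact ⟨_, isRamseyBound_zero_uniformity a b⟩
  | succ k ihk =>
    induction a generalizing b with
    | zero => exact ⟨_, isRamseyBound_zero_left k b⟩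
    | succ a iha =>
      induction b with
      | zero => exact ⟨_, (isRamseyBound_zero_left k (a + 1)).symm⟩
      | succ b ihb =>
        obtain ⟨N₁, h₁⟩ := iha (b + 1)
        obtain ⟨N₂, h₂⟩ := ihb
        obtain ⟨N, h⟩ := ihk N₁ N₂
        exact ⟨N + 1, h₁.succ h₂ h⟩

theorem exists_forall_subset_eq_const (k a : ℕ) : ∃ N : ℕ, ∀ ⦃α : Type u⦄
    (V : Finset α), N ≤ #V → ∀ p : Finset α → ZMod 2,
      ∃ T ⊆ V, #T = a ∧ ∃ c, ∀ K ⊆ T, #K = k → p K = c := by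
  obtain ⟨N, h⟩ := exists_isRamseyBound.{u} k a a
  refine ⟨N, fun _ V hV p => ?_⟩
  rcases h V hV (p · = 0) with ⟨T, hTV, hT, hp⟩ | ⟨T, hTV, hT, hp⟩
  · exact ⟨T, hTV, hT, 0, hp⟩
  · exact ⟨T, hTV, hT, 1, fun K hK hKk => Fin.eq_one_of_ne_zero _ (hp K hK hKk)⟩

end Ramsey

section BinomialMean

open Finset
open scoped BigOperators ZMod

/-- The mean of `f` under the binomial distribution with parameters `n` and `1 / 2`, that is, the
mean of `f` at the Hamming weight of a uniformly random point of the `n`-dimensional cube. -/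
def binomialMean {K : Type*} [Field K] (n : ℕ) (f : ℕ → K) : K :=
  (∑ m ∈ range (n + 1), n.choose m * f m) / 2 ^ n

theorem expect_powerset_apply_card {K α : Type*} [Field K] [CharZero K] (V : Finset α)
    (f : ℕ → K) : 𝔼 X ∈ V.powerset, f #X = binomialMean #V f := by
  rw [expect_eq_sum_div_card, sum_powerset_apply_card, card_powerset, binomialMean]
  simp only [nsmul_eq_mul, Nat.cast_pow, Nat.cast_ofNat]

theorem ofReal_binomialMean (n : ℕ) (f : ℕ → ℝ) :
    ((binomialMean n f : ℝ) : ℂ) = binomialMean n fun m => (f m : ℂ) := by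
  simp only [binomialMean]
  push_cast
  rfl

theorem binomialMean_const_mul {K : Type*} [Field K] (n : ℕ) (c : K) (f : ℕ → K) :
    binomialMean n (fun m => c * f m) = c * binomialMean n f := by
  simp only [binomialMean, mul_left_comm _ c, ← mul_sum, mul_div_assoc]

theorem binomialMean_sum {K ι : Type*} [Field K] (n : ℕ) (s : Finset ι) (f : ι → ℕ → K) :
    binomialMean n (fun m => ∑ i ∈ s, f i m) = ∑ i ∈ s, binomialMean n (f i) := by
  simp only [binomialMean, mul_sum]
  rw [sum_comm, sum_div]

theorem binomialMean_pow {K : Type*} [Field K] (n : ℕ) (z : K) :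
    binomialMean n (fun m => z ^ m) = ((1 + z) / 2) ^ n := by
  rw [binomialMean, div_pow, add_comm 1 z, add_pow]
  simp only [one_pow, mul_one, mul_comm]

theorem norm_one_add_div_two_lt_one {z : ℂ} (hz : ‖z‖ = 1) (hz₁ : z ≠ 1) :
    ‖(1 + z) / 2‖ < 1 := by
  have hray : ¬SameRay ℝ 1 z :=
    (not_sameRay_iff_of_norm_eq (by rw [norm_one, hz])).mpr hz₁.symm
  have := norm_add_lt_of_not_sameRay hray
  rw [norm_div, Complex.norm_two, div_lt_one two_pos]
  rwa [norm_one, hz, one_add_one_eq_two] at this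

section ZMod

variable {N : ℕ} [NeZero N]

theorem binomialMean_eq_sum_dft (n : ℕ) (φ : ZMod N → ℂ) :
    binomialMean n (fun m => φ m) =
      (N : ℂ)⁻¹ * ∑ j, 𝓕 φ j * ((1 + ZMod.stdAddChar j) / 2) ^ n := by
  have hinversion (m : ℕ) :
      φ m = (N : ℂ)⁻¹ * ∑ j, 𝓕 φ j * (ZMod.stdAddChar j : ℂ) ^ m := by
    rw [← ZMod.dft.symm_apply_apply φ, ZMod.invDFT_apply, LinearEquiv.symm_apply_apply,
      smul_eq_mul]
    simp only [smul_eq_mul, mul_comm _ (m : ZMod N), ← nsmul_eq_mul, AddChar.map_nsmul_eq_pow,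
      mul_comm (_ ^ m)]
  simp only [hinversion, binomialMean_const_mul, binomialMean_sum, binomialMean_pow]

theorem norm_dft_le {φ : ZMod N → ℂ} (hφ : ∀ a, ‖φ a‖ ≤ 1) (j : ZMod N) : ‖𝓕 φ j‖ ≤ N := by
  rw [ZMod.dft_apply]
  refine (norm_sum_le _ _).trans <| (sum_le_card_nsmul _ _ 1 fun a _ => ?_).trans_eq ?_
  · rw [norm_smul, ZMod.stdAddChar_apply, Circle.norm_coe, one_mul]
    exact hφ a
  · rw [card_univ, ZMod.card, nsmul_one]

theorem norm_binomialMean_sub_le (n : ℕ) {φ : ZMod N → ℂ} (hφ : ∀ a, ‖φ a‖ ≤ 1) :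
    ‖binomialMean n (fun m => φ m) - (N : ℂ)⁻¹ * ∑ a, φ a‖ ≤
      ∑ j ∈ univ.erase (0 : ZMod N), ‖(1 + ZMod.stdAddChar j : ℂ) / 2‖ ^ n := by
  have hN : (N : ℝ) ≠ 0 := Nat.cast_ne_zero.mpr (NeZero.ne N)
  rw [binomialMean_eq_sum_dft, ← add_sum_erase _ _ (mem_univ (0 : ZMod N)),
    ZMod.dft_apply_zero, AddChar.map_zero_eq_one, one_add_one_eq_two, div_self two_ne_zero,
    one_pow, mul_one, mul_add, add_sub_cancel_left, norm_mul, norm_inv, Complex.norm_natCast,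
    inv_mul_le_iff₀ (by positivity), mul_sum]
  refine norm_sum_le_of_le _ fun j _ => ?_
  rw [norm_mul, norm_pow]
  gcongr
  exact norm_dft_le hφ j

variable (N) in
theorem tendsto_sum_norm_one_add_stdAddChar_pow :
    Tendsto (fun n : ℕ => ∑ j ∈ univ.erase (0 : ZMod N),
      ‖(1 + ZMod.stdAddChar j : ℂ) / 2‖ ^ n) atTop (𝓝 0) := by
  have hlt {j : ZMod N} (hj : j ∈ univ.erase 0) : ‖(1 + ZMod.stdAddChar j : ℂ) / 2‖ < 1 := by
    refine norm_one_add_div_two_lt_one (by rw [ZMod.stdAddChar_apply, Circle.norm_coe]) ?_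
    rw [← AddChar.map_zero_eq_one (ZMod.stdAddChar (N := N))]
    exact ZMod.injective_stdAddChar.ne (ne_of_mem_erase hj)
  simpa only [sum_const_zero] using tendsto_finsetSum (univ.erase (0 : ZMod N)) fun j hj =>
    tendsto_pow_atTop_nhds_zero_of_lt_one (norm_nonneg _) (hlt hj)

end ZMod

theorem sum_zmod_eq_sum_range {N : ℕ} [NeZero N] {M : Type*} [AddCommMonoid M] (f : ℕ → M) :
    ∑ a : ZMod N, f a.val = ∑ m ∈ range N, f m := by
  refine sum_nbij' ZMod.val Nat.cast ?_ ?_ ?_ ?_ ?_ <;>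
    simp +contextual [ZMod.val_lt, Nat.mod_eq_of_lt]

/-- The rate `δ` depends on the period only: the bias estimate for polynomials needs the
convergence to be uniform over all periodic functions. -/
theorem exists_tendsto_abs_binomialMean_sub_le (N : ℕ) [NeZero N] :
    ∃ δ : ℕ → ℝ, Tendsto δ atTop (𝓝 0) ∧ ∀ n (f : ℕ → ℝ), Function.Periodic f N →
      (∀ m, |f m| ≤ 1) → |binomialMean n f - 𝔼 m ∈ range N, f m| ≤ δ n := by
  refine ⟨_, tendsto_sum_norm_one_add_stdAddChar_pow N, fun n f hf hf₁ => ?_⟩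
  have h := norm_binomialMean_sub_le n (φ := fun a : ZMod N => (f a.val : ℂ)) fun a => by
    simpa using hf₁ a.val
  have hval (m : ℕ) : f (m : ZMod N).val = f m := by rw [ZMod.val_natCast, hf.map_mod_nat]
  simp only [hval, sum_zmod_eq_sum_range fun m => (f m : ℂ)] at h
  rw [expect_eq_sum_div_card, card_range]
  rwa [← ofReal_binomialMean, ← Complex.ofReal_sum, ← Complex.ofReal_natCast,
    ← Complex.ofReal_inv, ← Complex.ofReal_mul, ← Complex.ofReal_sub, Complex.norm_real,
    Real.norm_eq_abs, inv_mul_eq_div] at h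

theorem tendsto_binomialMean_of_periodic {N : ℕ} [NeZero N] {f : ℕ → ℝ}
    (hf : Function.Periodic f N) (hf₁ : ∀ m, |f m| ≤ 1) :
    Tendsto (fun n => binomialMean n f) atTop (𝓝 (𝔼 m ∈ range N, f m)) := by
  obtain ⟨δ, hδ, h⟩ := exists_tendsto_abs_binomialMean_sub_le N
  exact tendsto_iff_dist_tendsto_zero.mpr <|
    squeeze_zero (fun _ => dist_nonneg) (fun n => h n f hf hf₁) hδ

end BinomialMean

section Kummer

variable {p : ℕ} [hp : Fact p.Prime]

theorem sum_digits_add_mul {b r : ℕ} (hr : r < b) (hb : 1 < b) (q : ℕ) :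
    (b.digits (r + b * q)).sum = r + (b.digits q).sum := by
  by_cases h : r ≠ 0 ∨ q ≠ 0
  · rw [Nat.digits_add b hb r q hr h, List.sum_cons]
  · push Not at h
    simp [h]

theorem padicValNat_choose_add_mul {r : ℕ} (hr : r < p) (w k : ℕ) :
    padicValNat p ((r + p * w).choose (p * k)) = padicValNat p (w.choose k) := by
  have hp₁ := hp.out.one_lt
  rcases lt_or_ge w k with hwk | hkw
  · have : r + p * w < p * k := by nlinarith
    rw [Nat.choose_eq_zero_of_lt hwk, Nat.choose_eq_zero_of_lt this]
  have hpkw : p * k ≤ r + p * w := (Nat.mul_le_mul_left p hkw).trans (Nat.le_add_left _ _)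
  have hsub : r + p * w - p * k = r + p * (w - k) := by
    rw [Nat.add_sub_assoc (Nat.mul_le_mul_left p hkw), Nat.mul_sub]
  have hdigits := sum_digits_add_mul (Nat.zero_lt_of_lt hr) hp₁ k
  simp only [zero_add] at hdigits
  refine Nat.eq_of_mul_eq_mul_left (Nat.sub_pos_of_lt hp₁) ?_
  rw [sub_one_mul_padicValNat_choose_eq_sub_sum_digits hkw,
    sub_one_mul_padicValNat_choose_eq_sub_sum_digits hpkw, hsub, hdigits,
    sum_digits_add_mul hr hp₁, sum_digits_add_mul hr hp₁]
  omega

theorem padicValNat_choose_pow_mul (m w k : ℕ) :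
    padicValNat p (w.choose (p ^ m * k)) = padicValNat p ((w / p ^ m).choose k) := by
  induction m generalizing w with
  | zero => simp
  | succ m ih =>
    calc padicValNat p (w.choose (p ^ (m + 1) * k))
        = padicValNat p ((w % p + p * (w / p)).choose (p * (p ^ m * k))) := by
          rw [Nat.mod_add_div, pow_succ', mul_assoc]
      _ = padicValNat p ((w / p).choose (p ^ m * k)) :=
          padicValNat_choose_add_mul (Nat.mod_lt _ hp.out.pos) _ _
      _ = padicValNat p ((w / p ^ (m + 1)).choose k) := by
          rw [ih, Nat.div_div_eq_div_mul, pow_succ']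

theorem pow_dvd_choose_pow_mul_iff (e m w k : ℕ) :
    p ^ e ∣ w.choose (p ^ m * k) ↔ p ^ e ∣ (w / p ^ m).choose k := by
  have hpm : 0 < p ^ m := pow_pos hp.out.pos m
  rcases lt_or_ge (w / p ^ m) k with hlt | hle
  · rw [Nat.choose_eq_zero_of_lt hlt,
      Nat.choose_eq_zero_of_lt (by rwa [mul_comm, ← Nat.div_lt_iff_lt_mul hpm])]
  · have hle' : p ^ m * k ≤ w := by rwa [mul_comm, ← Nat.le_div_iff_mul_le hpm]
    rw [padicValNat_dvd_iff_le (Nat.choose_pos hle').ne',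
      padicValNat_dvd_iff_le (Nat.choose_pos hle).ne', padicValNat_choose_pow_mul]

end Kummer

theorem four_mul_modEq_eight_iff (a b : ℕ) :
    4 * a ≡ b [MOD 8] ↔ 4 ∣ b ∧ (8 ∣ b ↔ 2 ∣ a) := by
  rw [Nat.ModEq]
  omega

theorem choose_add_modEq {m N j : ℕ} (hj : 0 < j) (h : ∀ i, 0 < i → i < j → m ∣ N.choose i)
    (u : ℕ) : (u + N).choose j ≡ u.choose j + N.choose j [MOD m] := by
  obtain ⟨j, rfl⟩ := Nat.exists_eq_add_one_of_ne_zero hj.ne'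
  rw [Nat.add_choose_eq,
    Finset.Nat.sum_antidiagonal_eq_sum_range_succ fun a b => u.choose a * N.choose b,
    Finset.sum_range_succ, Finset.sum_range_succ']
  have hmiddle : ∑ i ∈ Finset.range j, u.choose (i + 1) * N.choose (j + 1 - (i + 1)) ≡ 0 [MOD m] :=
    Nat.modEq_zero_iff_dvd.mpr <| Finset.dvd_sum fun i hi =>
      (h _ (by have := Finset.mem_range.mp hi; omega) (by omega)).mul_left _
  simpa [add_comm] using (hmiddle.add_right (N.choose (j + 1))).add_right (u.choose (j + 1))

theorem choose_add_prime_pow_modEq {p e j : ℕ} (hp : p.Prime) (hj : j < p ^ e) (u : ℕ) :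
    (u + p ^ e).choose j ≡ u.choose j [MOD p] := by
  have hdvd {i : ℕ} (hi : 0 < i) (hie : i < p ^ e) : p ∣ (p ^ e).choose i :=
    hp.dvd_choose_pow hi.ne' hie.ne
  rcases j.eq_zero_or_pos with rfl | hj₀
  · simp only [Nat.choose_zero_right, Nat.ModEq.refl]
  · exact (choose_add_modEq hj₀ (fun i hi hij => hdvd hi (hij.trans hj)) u).trans
      ((Nat.modEq_zero_iff_dvd.mpr (hdvd hj₀ hj)).add_left (u.choose j))

theorem choose_add_prime_pow_self_modEq {p : ℕ} (hp : p.Prime) (e u : ℕ) :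
    (u + p ^ e).choose (p ^ e) ≡ u.choose (p ^ e) + 1 [MOD p] := by
  simpa using choose_add_modEq (pow_pos hp.pos e)
    (fun i hi hie => hp.dvd_choose_pow hi.ne' hie.ne) u

/-- The weights `u` at which the integer values of the elementary symmetric polynomials satisfy
`e₄ / 2 = e₃ / 8` modulo `1`. -/
def IsAgreementWeight (u : ℕ) : Prop :=
  4 * u.choose 4 ≡ u.choose 3 [MOD 8]

instance : DecidablePred IsAgreementWeight :=
  fun u => inferInstanceAs (Decidable (4 * u.choose 4 ≡ u.choose 3 [MOD 8]))

theorem isAgreementWeight_periodic : Function.Periodic IsAgreementWeight 16 := by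
  intro u
  have h₃ : (u + 16).choose 3 ≡ u.choose 3 [MOD 8] :=
    (choose_add_modEq three_pos (fun i _ _ => by interval_cases i <;> decide) u).trans
      (Nat.ModEq.add_left (b := 0) _ (by decide))
  have h₄ : (u + 16).choose 4 ≡ u.choose 4 [MOD 2] :=
    (choose_add_modEq four_pos (fun i _ _ => by interval_cases i <;> decide) u).trans
      (Nat.ModEq.add_left (b := 0) _ (by decide))
  have h₄' := h₄.mul_left' 4
  exact propext ⟨fun h => h₄'.symm.trans (h.trans h₃), fun h => h₄'.trans (h.trans h₃.symm)⟩

theorem isAgreementWeight_div_two_pow_iff (m w : ℕ) :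
    IsAgreementWeight (w / 2 ^ m) ↔
      4 * w.choose (2 ^ m * 4) ≡ w.choose (2 ^ m * 3) [MOD 8] := by
  have h (e k : ℕ) := pow_dvd_choose_pow_mul_iff (p := 2) e m w k
  have h₂ := h 1 4
  have h₄ := h 2 3
  have h₈ := h 3 3
  norm_num only at h₂ h₄ h₈
  rw [IsAgreementWeight, four_mul_modEq_eight_iff, four_mul_modEq_eight_iff, h₂, h₄, h₈]

theorem sum_range_mul_div {M : Type*} [AddCommMonoid M] (g : ℕ → M) {b : ℕ} (hb : 0 < b) (n : ℕ) :
    ∑ w ∈ Finset.range (b * n), g (w / b) = b • ∑ u ∈ Finset.range n, g u := by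
  induction n with
  | zero => simp
  | succ n ih =>
    have hblock : ∀ i ∈ Finset.range b, g ((b * n + i) / b) = g n := fun i hi => by
      rw [Nat.mul_add_div hb, Nat.div_eq_of_lt (Finset.mem_range.mp hi), add_zero]
    rw [mul_add_one, Finset.sum_range_add, ih, Finset.sum_range_succ, smul_add,
      Finset.sum_congr rfl hblock, Finset.sum_const, Finset.card_range]

open scoped BigOperators Finset in
theorem expect_isAgreementWeight (m : ℕ) :
    𝔼 w ∈ Finset.range (2 ^ m * 16), (if IsAgreementWeight (w / 2 ^ m) then 1 else 0 : ℝ) =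
      9 / 16 := by
  have hcount : #{u ∈ Finset.range 16 | IsAgreementWeight u} = 9 := by decide
  rw [Finset.expect_eq_sum_div_card,
    sum_range_mul_div (fun u => if IsAgreementWeight u then (1 : ℝ) else 0) (by positivity),
    Finset.sum_boole, hcount, Finset.card_range]
  push_cast
  rw [nsmul_eq_mul]
  field_simp
  norm_num

section CubePolynomial

open Finset
open scoped BigOperators

section PowersetUnion

variable {α M : Type*} [DecidableEq α] [AddCommMonoid M] {s t : Finset α}

theorem injOn_union_powerset_product (h : Disjoint s t) :
    Set.InjOn (fun q : Finset α × Finset α => q.1 ∪ q.2) ↑(s.powerset ×ˢ t.powerset) := by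
  have hinter {A B : Finset α} (hA : A ⊆ s) (hB : B ⊆ t) : (A ∪ B) ∩ s = A ∧ (A ∪ B) ∩ t = B := by
    rw [union_inter_distrib_right, union_inter_distrib_right, inter_eq_left.mpr hA,
      inter_eq_left.mpr hB, disjoint_iff_inter_eq_empty.mp (h.symm.mono_left hB),
      disjoint_iff_inter_eq_empty.mp (h.mono_left hA), union_empty, empty_union]
    exact ⟨rfl, rfl⟩
  rintro ⟨A, B⟩ hAB ⟨A', B'⟩ hAB' (heq : A ∪ B = A' ∪ B')
  simp only [coe_product, coe_powerset, Set.mem_prod, Set.mem_preimage, Set.mem_powerset_iff,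
    coe_subset] at hAB hAB'
  obtain ⟨hA, hB⟩ := hinter hAB.1 hAB.2
  obtain ⟨hA', hB'⟩ := hinter hAB'.1 hAB'.2
  rw [heq] at hA hB
  exact Prod.ext (hA.symm.trans hA') (hB.symm.trans hB')

theorem image_union_powerset_product :
    (s.powerset ×ˢ t.powerset).image (fun q => q.1 ∪ q.2) = (s ∪ t).powerset :=
  (image_sup_product _ _).trans (powerset_union s t).symm

theorem sum_powerset_union (h : Disjoint s t) (f : Finset α → M) :
    ∑ X ∈ (s ∪ t).powerset, f X = ∑ A ∈ s.powerset, ∑ B ∈ t.powerset, f (A ∪ B) := by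
  rw [← image_union_powerset_product, sum_image (injOn_union_powerset_product h), sum_product]

theorem expect_powerset_union [Module ℚ≥0 M] (h : Disjoint s t) (f : Finset α → M) :
    𝔼 X ∈ (s ∪ t).powerset, f X = 𝔼 A ∈ s.powerset, 𝔼 B ∈ t.powerset, f (A ∪ B) := by
  rw [← image_union_powerset_product, expect_image (injOn_union_powerset_product h),
    expect_product]

end PowersetUnion

/-- The value at the indicator vector of `X` of the multilinear polynomial whose monomial
`∏ i ∈ M, x i` has coefficient `p M`. -/
def multilinearEval {α R : Type*} [AddCommMonoid R] (p : Finset α → R) (X : Finset α) : R :=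
  ∑ M ∈ X.powerset, p M

/-- The coefficients of the multilinear polynomial obtained from the one with coefficients `p` by
substituting `1` for the variables in `Y`; it is meant for polynomials in variables outside `Y`. -/
def substOne {α R : Type*} [DecidableEq α] [AddCommMonoid R] (p : Finset α → R) (Y M : Finset α) :
    R :=
  ∑ L ∈ Y.powerset, p (L ∪ M)

theorem multilinearEval_union {α R : Type*} [DecidableEq α] [AddCommMonoid R] (p : Finset α → R)
    {Y X : Finset α} (h : Disjoint Y X) :
    multilinearEval p (Y ∪ X) = multilinearEval (substOne p Y) X := by
  rw [multilinearEval, sum_powerset_union h, sum_comm]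
  rfl

theorem multilinearEval_add {α R : Type*} [AddCommMonoid R] (p q : Finset α → R) (X : Finset α) :
    multilinearEval (p + q) X = multilinearEval p X + multilinearEval q X :=
  sum_add_distrib

/-- The additive character `a ↦ (-1) ^ a` of `𝔽₂`. -/
noncomputable def signChar : AddChar (ZMod 2) ℝ :=
  AddChar.zmodChar 2 neg_one_sq

theorem signChar_add_one (a : ZMod 2) : signChar (a + 1) = -signChar a := by
  have h : signChar 1 = -1 := by simp [signChar, AddChar.zmodChar_apply, ZMod.val_one]
  rw [AddChar.map_add_eq_mul, h, mul_neg_one]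

theorem abs_signChar (a : ZMod 2) : |signChar a| = 1 := by
  rw [signChar, AddChar.zmodChar_apply, abs_neg_one_pow]

/-- The bias of the polynomial over `𝔽₂` with coefficients `p`, in the variables `V`: the mean of
`(-1) ^ p(x)` over all points `x`. -/
noncomputable def bias {α : Type*} (V : Finset α) (p : Finset α → ZMod 2) : ℝ :=
  𝔼 X ∈ V.powerset, signChar (multilinearEval p X)

section Restriction

variable {α : Type*} [DecidableEq α] {V T : Finset α} {p : Finset α → ZMod 2}

theorem bias_eq_expect_substOne (hT : T ⊆ V) :
    bias V p = 𝔼 Y ∈ (V \ T).powerset, bias T (substOne p Y) := by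
  rw [bias, ← sdiff_union_of_subset hT, expect_powerset_union sdiff_disjoint,
    sdiff_union_of_subset hT]
  refine expect_congr rfl fun Y hY => expect_congr rfl fun X hX => ?_
  rw [multilinearEval_union p
    (sdiff_disjoint.mono (mem_powerset.mp hY) (mem_powerset.mp hX))]

theorem abs_bias_le (hT : T ⊆ V) {ε : ℝ} (h : ∀ Y ⊆ V \ T, |bias T (substOne p Y)| ≤ ε) :
    |bias V p| ≤ ε := by
  rw [bias_eq_expect_substOne hT]
  exact (abs_expect_le _ _).trans <|
    expect_le (powerset_nonempty _) fun Y hY => h Y (mem_powerset.mp hY)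

end Restriction

/-- The coefficients `p` of the monomials of degree at least `k` in the variables `V` are those of
a symmetric polynomial: they are given by `s` as a function of the degree. -/
def IsSymmetricFrom {α R : Type*} (k : ℕ) (V : Finset α) (p : Finset α → R) (s : ℕ → R) : Prop :=
  ∀ M ⊆ V, k ≤ #M → p M = s #M

/-- `s` gives the coefficients, as a function of the degree, of a symmetric polynomial of degree
`D` with leading coefficient `1`. -/
def IsMonicProfile {R : Type*} [Zero R] [One R] (D : ℕ) (s : ℕ → R) : Prop :=
  s D = 1 ∧ ∀ j, D < j → s j = 0

section Profile

variable {α R : Type*} {k D : ℕ} {s : ℕ → R}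

theorem IsMonicProfile.update [Zero R] [One R] (hs : IsMonicProfile D s) (hk : k < D) (c : R) :
    IsMonicProfile D (Function.update s k c) :=
  ⟨by rw [Function.update_of_ne hk.ne', hs.1],
    fun j hj => by rw [Function.update_of_ne (hk.trans hj).ne', hs.2 j hj]⟩

theorem IsMonicProfile.sum_powerset [AddCommMonoidWithOne R] (hs : IsMonicProfile D s)
    (Y : Finset α) : IsMonicProfile D fun j => ∑ L ∈ Y.powerset, s (#L + j) := by
  refine ⟨?_, fun j hj => sum_eq_zero fun L _ => hs.2 _ (hj.trans_le (Nat.le_add_left _ _))⟩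
  change ∑ L ∈ Y.powerset, s (#L + D) = 1
  rw [sum_eq_single_of_mem ∅ (empty_mem_powerset Y) fun L _ hL =>
    hs.2 _ (Nat.lt_add_of_pos_left (card_pos.mpr (nonempty_iff_ne_empty.mpr hL))), card_empty,
    zero_add, hs.1]

theorem IsSymmetricFrom.substOne_update [DecidableEq α] [AddCommMonoid R] {V T Y : Finset α}
    {p : Finset α → R} (h : IsSymmetricFrom (k + 1) V p s) (hT : T ⊆ V) (hY : Y ⊆ V \ T) {c : R}
    (hc : ∀ K ⊆ T, #K = k → p K = c) :
    IsSymmetricFrom k T (substOne p Y) fun j =>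
      ∑ L ∈ Y.powerset, Function.update s k c (#L + j) := by
  intro M hM hkM
  refine sum_congr rfl fun L hL => ?_
  rw [mem_powerset] at hL
  have hcard : #(L ∪ M) = #L + #M := card_union_of_disjoint (sdiff_disjoint.mono (hL.trans hY) hM)
  rcases eq_or_ne (#L + #M) k with hk | hk
  · obtain rfl : L = ∅ := card_eq_zero.mp (by omega)
    rw [hk, Function.update_self, empty_union]
    exact hc M hM (by simpa using hk)
  · rw [Function.update_of_ne hk, ← hcard]
    exact h _ (union_subset (hL.trans (hY.trans sdiff_subset)) (hM.trans hT)) (by omega)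

theorem IsSymmetricFrom.multilinearEval_eq [Semiring R] {V X : Finset α} {p : Finset α → R}
    (h : IsSymmetricFrom 0 V p s) (hs : IsMonicProfile D s) (hX : X ⊆ V) :
    multilinearEval p X = ∑ j ∈ range (D + 1), ((#X).choose j : R) * s j := by
  have hp : multilinearEval p X = ∑ M ∈ X.powerset, s #M :=
    sum_congr rfl fun M hM => h M ((mem_powerset.mp hM).trans hX) (Nat.zero_le _)
  rw [hp, sum_powerset_apply_card]
  simp only [nsmul_eq_mul]
  rw [← eventually_constant_sum _ (le_max_left (#X + 1) (D + 1)),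
    eventually_constant_sum _ (le_max_right (#X + 1) (D + 1))]
  · exact fun j hj => by rw [hs.2 j hj, mul_zero]
  · exact fun j hj => by rw [Nat.choose_eq_zero_of_lt hj, Nat.cast_zero, zero_mul]

end Profile

theorem sum_choose_mul_add_prime_pow {p : ℕ} [hp : Fact p.Prime] {R : Type*} [Ring R]
    [CharP R p] {e : ℕ} {s : ℕ → R} (hs : s (p ^ e) = 1) (w : ℕ) :
    ∑ j ∈ range (p ^ e + 1), ((w + p ^ e).choose j : R) * s j =
      ∑ j ∈ range (p ^ e + 1), (w.choose j : R) * s j + 1 := by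
  have hlow {j : ℕ} (hj : j < p ^ e) : ((w + p ^ e).choose j : R) = w.choose j :=
    (CharP.natCast_eq_natCast R p).mpr (choose_add_prime_pow_modEq hp.out hj w)
  have htop : ((w + p ^ e).choose (p ^ e) : R) = (w.choose (p ^ e) : ℕ) + 1 := by
    exact_mod_cast (CharP.natCast_eq_natCast R p).mpr (choose_add_prime_pow_self_modEq hp.out e w)
  rw [sum_range_succ, sum_range_succ, htop, hs, mul_one, mul_one, ← add_assoc,
    sum_congr rfl fun j hj => by rw [hlow (mem_range.mp hj)]]

theorem expect_range_eq_zero_of_antiperiodic {N : ℕ} {f : ℕ → ℝ} (hf : Function.Antiperiodic f N) :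
    𝔼 m ∈ range (2 * N), f m = 0 := by
  have hsum : ∑ m ∈ range N, f (N + m) = -∑ m ∈ range N, f m := by
    rw [← sum_neg_distrib]
    exact sum_congr rfl fun m _ => by rw [add_comm, hf]
  rw [expect_eq_sum_div_card, two_mul, sum_range_add, hsum, add_neg_cancel, zero_div]

theorem exists_forall_abs_bias_le_of_isSymmetricFrom_zero (e : ℕ) {ε : ℝ} (hε : 0 < ε) :
    ∃ N, ∀ ⦃α : Type u⦄ (V : Finset α) (p : Finset α → ZMod 2) (s : ℕ → ZMod 2),
      N ≤ #V → IsMonicProfile (2 ^ e) s → IsSymmetricFrom 0 V p s → |bias V p| ≤ ε := by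
  obtain ⟨δ, hδ, hmean⟩ := exists_tendsto_abs_binomialMean_sub_le (2 * 2 ^ e)
  obtain ⟨N, hN⟩ := eventually_atTop.mp (hδ.eventually_le_const hε)
  refine ⟨N, fun α V p s hV hs hp => ?_⟩
  set f : ℕ → ℝ := fun w => signChar (∑ j ∈ range (2 ^ e + 1), (w.choose j : ZMod 2) * s j)
  have hf : Function.Antiperiodic f ((2 ^ e : ℕ) : ℕ) := fun w => by
    simp only [f]
    rw [sum_choose_mul_add_prime_pow hs.1, signChar_add_one]
  have hbias : bias V p = binomialMean #V f := by
    rw [← expect_powerset_apply_card]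
    exact expect_congr rfl fun X hX => by rw [hp.multilinearEval_eq hs (mem_powerset.mp hX)]
  have h := hmean #V f hf.periodic_two_mul fun w => (abs_signChar _).le
  rw [expect_range_eq_zero_of_antiperiodic hf, sub_zero] at h
  rw [hbias]
  exact h.trans (hN _ hV)

theorem exists_forall_abs_bias_le {e k : ℕ} (hk : k ≤ 2 ^ e) {ε : ℝ} (hε : 0 < ε) :
    ∃ N, ∀ ⦃α : Type u⦄ (V : Finset α) (p : Finset α → ZMod 2) (s : ℕ → ZMod 2),
      N ≤ #V → IsMonicProfile (2 ^ e) s → IsSymmetricFrom k V p s → |bias V p| ≤ ε := by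
  classical
  induction k with
  | zero => exact exists_forall_abs_bias_le_of_isSymmetricFrom_zero e hε
  | succ k ih =>
    obtain ⟨a, ha⟩ := ih (Nat.le_of_succ_le hk)
    obtain ⟨N, hN⟩ := exists_forall_subset_eq_const.{u} k a
    refine ⟨N, fun α V p s hV hs hp => ?_⟩
    obtain ⟨T, hTV, hT, c, hc⟩ := hN V hV p
    exact abs_bias_le hTV fun Y hY =>
      ha T _ _ hT.ge ((hs.update hk c).sum_powerset Y) (hp.substOne_update hTV hY hc)

end CubePolynomial

section Agreement

open Finset
open scoped BigOperators

theorem agr_eq_expect {D R : Type*} [Fintype D] (F G : D → R) [DecidablePred fun x => F x = G x] :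
    agr F G = 𝔼 x, if F x = G x then (1 : ℝ) else 0 := by
  rw [agr, expect_eq_sum_div_card, sum_boole, card_univ]
  congr!

theorem agr_le_one {D R : Type*} [Fintype D] (F G : D → R) : agr F G ≤ 1 :=
  div_le_one_of_le₀ (Nat.cast_le.mpr (card_le_univ _)) (Nat.cast_nonneg _)

/-- The point of the cube `𝔽₂ⁿ` whose support is `X`. -/
def indicatorPoint {n : ℕ} (X : Finset (Fin n)) (i : Fin n) : ZMod 2 :=
  if i ∈ X then 1 else 0

theorem indicatorPoint_bijective {n : ℕ} :
    Function.Bijective (indicatorPoint : Finset (Fin n) → Fin n → ZMod 2) := by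
  refine (Fintype.bijective_iff_injective_and_card _).mpr ⟨fun X Y h => ?_, by simp⟩
  ext i
  have hi : (if i ∈ X then (1 : ZMod 2) else 0) = if i ∈ Y then 1 else 0 := congrFun h i
  by_cases hX : i ∈ X <;> by_cases hY : i ∈ Y <;> simp_all

theorem agr_eq_expect_powerset {n : ℕ} {R : Type*} (F G : (Fin n → ZMod 2) → R)
    {q : Finset (Fin n) → Prop} [DecidablePred q]
    (hq : ∀ X, F (indicatorPoint X) = G (indicatorPoint X) ↔ q X) :
    agr F G = 𝔼 X ∈ (univ : Finset (Fin n)).powerset, if q X then (1 : ℝ) else 0 := by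
  classical
  rw [agr_eq_expect, powerset_univ]
  refine (Fintype.expect_bijective _ indicatorPoint_bijective _ _ fun X => ?_).symm
  simp only [hq]

theorem prod_ite_mem_one_zero {α R : Type*} [DecidableEq α] [CommMonoidWithZero R]
    (S X : Finset α) :
    ∏ i ∈ S, (if i ∈ X then (1 : R) else 0) = if S ⊆ X then 1 else 0 := by
  rw [prod_ite_zero, prod_const_one]
  rfl

theorem prod_indicatorPoint {n : ℕ} (S X : Finset (Fin n)) :
    ∏ i ∈ S, indicatorPoint X i = if S ⊆ X then 1 else 0 :=
  prod_ite_mem_one_zero S X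

theorem prod_val_indicatorPoint {n : ℕ} (S X : Finset (Fin n)) :
    ∏ i ∈ S, ((indicatorPoint X i).val : ℝ) = if S ⊆ X then 1 else 0 := by
  rw [← prod_ite_mem_one_zero S X]
  refine prod_congr rfl fun i _ => ?_
  rw [indicatorPoint]
  split_ifs <;> simp [ZMod.val_one]

theorem sum_powersetCard_ite_subset {α M : Type*} [Fintype α] [DecidableEq α] [AddCommMonoid M]
    (t : ℕ) (X : Finset α) (a : M) :
    ∑ S ∈ powersetCard t univ, (if S ⊆ X then a else 0) = (#X).choose t • a := by
  have hfilter : (powersetCard t univ).filter (· ⊆ X) = powersetCard t X := by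
    ext S
    simp only [mem_filter, mem_powersetCard, subset_univ, true_and, and_comm]
  rw [← sum_filter, hfilter, sum_const, card_powersetCard]

theorem toTorus_eq_toAddCircle (a : ZMod 2) : toTorus a = ZMod.toAddCircle a := by
  rw [toTorus, ZMod.toAddCircle_apply, Nat.cast_ofNat]

theorem toTorus_inj {a b : ZMod 2} : toTorus a = toTorus b ↔ a = b := by
  rw [toTorus_eq_toAddCircle, toTorus_eq_toAddCircle, ZMod.toAddCircle_inj]

theorem elemSym_indicatorPoint (n t : ℕ) (X : Finset (Fin n)) :
    elemSym n t (indicatorPoint X) = toTorus ((#X).choose t : ℕ) := by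
  simp only [elemSym, MvPolynomial.esymm, map_sum, map_prod, MvPolynomial.eval_X,
    prod_indicatorPoint, sum_powersetCard_ite_subset, nsmul_one]

theorem multilinearEval_ite_card_eq {α R : Type*} [AddCommMonoidWithOne R] (t : ℕ) (X : Finset α) :
    multilinearEval (fun M => if #M = t then (1 : R) else 0) X = (#X).choose t := by
  rw [multilinearEval, ← sum_filter, sum_const, nsmul_one, ← powersetCard_eq_filter,
    card_powersetCard]

theorem ite_eq_one_add_signChar_div_two (a b : ZMod 2) :
    (if a = b then (1 : ℝ) else 0) = (1 + signChar (a + b)) / 2 := by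
  split_ifs with h
  · rw [h, CharTwo.add_self_eq_zero, AddChar.map_zero_eq_one, one_add_one_eq_two,
      div_self two_ne_zero]
  · have hadd : ∀ a b : ZMod 2, a ≠ b → a + b = 0 + 1 := by decide
    rw [hadd a b h, signChar_add_one, AddChar.map_zero_eq_one, add_neg_cancel, zero_div]

theorem agr_eq_one_add_bias_div_two {n : ℕ} {F G : (Fin n → ZMod 2) → UnitAddCircle}
    {p q : Finset (Fin n) → ZMod 2} (hF : ∀ X, F (indicatorPoint X) = toTorus (multilinearEval p X))
    (hG : ∀ X, G (indicatorPoint X) = toTorus (multilinearEval q X)) :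
    agr F G = (1 + bias univ (p + q)) / 2 := by
  rw [agr_eq_expect_powerset F G (q := fun X => multilinearEval p X = multilinearEval q X)
    fun X => by rw [hF, hG, toTorus_inj]]
  simp only [ite_eq_one_add_signChar_div_two, ← multilinearEval_add, ← expect_div,
    expect_add_distrib, expect_const (powerset_nonempty _)]
  rfl

end Agreement

namespace NonclassicalPolynomial

open Finset

variable {n : ℕ}

theorem eval_indicatorPoint (P : NonclassicalPolynomial n) (X : Finset (Fin n)) :
    P.eval (indicatorPoint X) =
      P.shift + ∑ t ∈ P.terms, if t.1 ⊆ X then ((1 / 2 ^ t.2 : ℝ) : UnitAddCircle) else 0 := by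
  rw [eval]
  congr! 2 with t
  rw [prod_val_indicatorPoint]
  split_ifs <;> simp

theorem IsClassical.snd_eq_one {P : NonclassicalPolynomial n} (hP : P.IsClassical)
    {t : Finset (Fin n) × ℕ} (ht : t ∈ P.terms) : t.2 = 1 :=
  ((le_sup (f := fun t => t.2) ht).trans hP.2).antisymm (P.one_le_of_mem t ht)

theorem IsClassical.sum_terms {P : NonclassicalPolynomial n} (hP : P.IsClassical)
    (X : Finset (Fin n)) :
    ∑ t ∈ P.terms, (if t.1 ⊆ X then ((1 / 2 ^ t.2 : ℝ) : UnitAddCircle) else 0) =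
      toTorus (multilinearEval (fun M => if (M, 1) ∈ P.terms then 1 else 0) X) := by
  have hone : toTorus 1 = ((1 / 2 : ℝ) : UnitAddCircle) := by
    rw [toTorus, ZMod.val_one, Nat.cast_one]
  have hterm (M : Finset (Fin n)) : toTorus (if (M, 1) ∈ P.terms then 1 else 0) =
      if (M, 1) ∈ P.terms then ((1 / 2 : ℝ) : UnitAddCircle) else 0 := by
    rw [apply_ite toTorus, hone, toTorus_eq_toAddCircle, map_zero]
  rw [toTorus_eq_toAddCircle, multilinearEval, map_sum]
  simp only [← toTorus_eq_toAddCircle, hterm]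
  rw [← sum_filter, ← sum_filter]
  refine sum_nbij' Prod.fst (·, 1) ?_ ?_ ?_ ?_ ?_
  · rintro ⟨M, k⟩ ht
    obtain ⟨ht, hMX⟩ := mem_filter.mp ht
    obtain rfl : k = 1 := hP.snd_eq_one ht
    exact mem_filter.mpr ⟨mem_powerset.mpr hMX, ht⟩
  · intro M hM
    obtain ⟨hMX, ht⟩ := mem_filter.mp hM
    exact mem_filter.mpr ⟨ht, mem_powerset.mp hMX⟩
  · exact fun t ht => Prod.ext rfl (hP.snd_eq_one (mem_filter.mp ht).1).symm
  · exact fun _ _ => rfl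
  · exact fun t ht => by rw [hP.snd_eq_one (mem_filter.mp ht).1, pow_one]

theorem IsClassical.exists_coeff {P : NonclassicalPolynomial n} (hP : P.IsClassical) :
    ∃ q : Finset (Fin n) → ZMod 2, (∀ M, P.degree < #M → q M = 0) ∧
      ∀ X, P.eval (indicatorPoint X) = toTorus (multilinearEval q X) := by
  obtain ⟨a, ha⟩ : ∃ a, P.shift = toTorus a := hP.1.elim (⟨0, ·⟩) (⟨1, ·⟩)
  refine ⟨Pi.single ∅ a + fun M => if (M, 1) ∈ P.terms then 1 else 0, fun M hM => ?_, fun X => ?_⟩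
  · have hne : M ≠ ∅ := card_pos.mp (Nat.zero_lt_of_lt hM) |>.ne_empty
    have hnotMem : (M, 1) ∉ P.terms := fun h =>
      hM.not_ge (le_sup (f := fun t : Finset (Fin n) × ℕ => #t.1 + (t.2 - 1)) h)
    rw [Pi.add_apply, Pi.single_eq_of_ne hne, if_neg hnotMem, add_zero]
  · have hsingle : multilinearEval (Pi.single ∅ a) X = a := by
      rw [multilinearEval, sum_pi_single', if_pos (empty_mem_powerset X)]
    rw [eval_indicatorPoint, ha, hP.sum_terms, multilinearEval_add, hsingle]
    simp only [toTorus_eq_toAddCircle, map_add]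

/-- The non-classical polynomial `e_D / 2 ^ k`, where `e_D` is the elementary symmetric polynomial
of degree `D` with integer values. -/
def dyadicElemSym (n : ℕ) {D k : ℕ} (hD : 0 < D) (hk : 1 ≤ k) : NonclassicalPolynomial n where
  shift := 0
  terms := powersetCard D univ ×ˢ {k}
  nonempty_of_mem t ht := card_pos.mp <| by
    rwa [(mem_powersetCard.mp (mem_product.mp ht).1).2]
  one_le_of_mem t ht := by rwa [mem_singleton.mp (mem_product.mp ht).2]

variable {D k : ℕ} (hD : 0 < D) (hk : 1 ≤ k)

theorem hasDyadicShift_dyadicElemSym : (dyadicElemSym n hD hk).HasDyadicShift :=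
  ⟨0, by positivity, by simp [dyadicElemSym]⟩

theorem degree_dyadicElemSym_le : (dyadicElemSym n hD hk).degree ≤ D + (k - 1) := by
  refine Finset.sup_le fun t ht => ?_
  rw [(mem_powersetCard.mp (mem_product.mp ht).1).2, mem_singleton.mp (mem_product.mp ht).2]

theorem eval_dyadicElemSym_indicatorPoint (X : Finset (Fin n)) :
    (dyadicElemSym n hD hk).eval (indicatorPoint X) =
      ZMod.toAddCircle ((#X).choose D : ZMod (2 ^ k)) := by
  rw [eval_indicatorPoint, dyadicElemSym, zero_add, sum_product]
  simp only [sum_singleton]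
  rw [sum_powersetCard_ite_subset, ← AddCircle.coe_nsmul, nsmul_eq_mul, mul_one_div,
    ZMod.toAddCircle_natCast]
  push_cast
  rfl

/-- The non-classical polynomial `e_D / 8` with `D = 2 ^ m * 3`, the one that agrees with the
elementary symmetric polynomial of degree `2 ^ (m + 2)` at more than half of the points. -/
abbrev eighthElemSym (n m : ℕ) : NonclassicalPolynomial n :=
  dyadicElemSym n (D := 2 ^ m * 3) (k := 3) (by positivity) (by norm_num)

end NonclassicalPolynomial

section ClassicalBound

open Finset

theorem exists_tendsto_zero_of_eventually_le {ι : Type*} {l : Filter ι} {A : ι → Set ℝ}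
    (hbdd : ∀ i, BddAbove (A i)) (h : ∀ δ > 0, ∀ᶠ i in l, ∀ r ∈ A i, r ≤ δ) :
    ∃ ε : ι → ℝ, Tendsto ε l (𝓝 0) ∧ ∀ i, ∀ r ∈ A i, r ≤ ε i := by
  refine ⟨fun i => max 0 (sSup (A i)), tendsto_order.mpr ⟨fun a ha => ?_, fun b hb => ?_⟩,
    fun i r hr => (le_csSup (hbdd i) hr).trans (le_max_right _ _)⟩
  · exact .of_forall fun i => ha.trans_le (le_max_left _ _)
  · filter_upwards [h (b / 2) (half_pos hb)] with i hi
    exact max_lt hb ((Real.sSup_le hi (half_pos hb).le).trans_lt (half_lt_self hb))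

theorem eventually_forall_isClassical_agr_le {d e : ℕ} (hd : d < 2 ^ e) {δ : ℝ} (hδ : 0 < δ) :
    ∀ᶠ n : ℕ in atTop, ∀ P : NonclassicalPolynomial n, P.IsClassical → P.degree ≤ d →
      agr (elemSym n (2 ^ e)) P.eval ≤ 1 / 2 + δ := by
  obtain ⟨N, hN⟩ := exists_forall_abs_bias_le (le_refl (2 ^ e)) (ε := 2 * δ) (by positivity)
  filter_upwards [eventually_ge_atTop N] with n hn P hP hPd
  obtain ⟨q, hq, hPq⟩ := hP.exists_coeff
  set p : Finset (Fin n) → ZMod 2 := fun M => if #M = 2 ^ e then 1 else 0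
  have hSp (X : Finset (Fin n)) :
      elemSym n (2 ^ e) (indicatorPoint X) = toTorus (multilinearEval p X) := by
    rw [elemSym_indicatorPoint, multilinearEval_ite_card_eq]
  have hmonic : IsMonicProfile (2 ^ e) fun j => if j = 2 ^ e then (1 : ZMod 2) else 0 :=
    ⟨if_pos rfl, fun j hj => if_neg hj.ne'⟩
  have hsymmetric : IsSymmetricFrom (2 ^ e) univ (p + q) fun j => if j = 2 ^ e then 1 else 0 :=
    fun M _ hM => by rw [Pi.add_apply, hq M (hPd.trans_lt (hd.trans_le hM)), add_zero]
  have hbias := hN univ (p + q) _ (by rwa [card_fin]) hmonic hsymmetric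
  rw [agr_eq_one_add_bias_div_two hSp hPq]
  linarith [le_abs_self (bias univ (p + q))]

theorem exists_tendsto_zero_forall_isClassical_agr_le {d e : ℕ} (hd : d < 2 ^ e) :
    ∃ ε : ℕ → ℝ, Tendsto ε atTop (𝓝 0) ∧ ∀ n (P : NonclassicalPolynomial n), P.IsClassical →
      P.degree ≤ d → agr (elemSym n (2 ^ e)) P.eval ≤ 1 / 2 + ε n := by
  obtain ⟨ε, hε, h⟩ := exists_tendsto_zero_of_eventually_le (l := atTop)
    (A := fun n => {r | ∃ P : NonclassicalPolynomial n, P.IsClassical ∧ P.degree ≤ d ∧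
      r = agr (elemSym n (2 ^ e)) P.eval - 1 / 2})
    (fun n => ⟨1 - 1 / 2, by
      rintro _ ⟨P, -, -, rfl⟩
      exact sub_le_sub_right (agr_le_one _ _) _⟩)
    (fun δ hδ => by
      filter_upwards [eventually_forall_isClassical_agr_le hd hδ] with n hn
      rintro _ ⟨P, hP, hPd, rfl⟩
      exact sub_le_iff_le_add'.mpr (hn P hP hPd))
  exact ⟨ε, hε, fun n P hP hPd => sub_le_iff_le_add'.mp (h n _ ⟨P, hP, hPd, rfl⟩)⟩

end ClassicalBound

section NonclassicalAgreement

open Finset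

theorem toAddCircle_natCast_mul (c N a : ℕ) [NeZero c] [NeZero N] :
    ZMod.toAddCircle ((c * a : ℕ) : ZMod (c * N)) = ZMod.toAddCircle (a : ZMod N) := by
  rw [ZMod.toAddCircle_natCast, ZMod.toAddCircle_natCast, Nat.cast_mul, Nat.cast_mul,
    mul_div_mul_left _ _ (NeZero.ne (c : ℝ))]

theorem elemSym_eq_eighthElemSym_iff {n : ℕ} (m : ℕ) (X : Finset (Fin n)) :
    elemSym n (2 ^ m * 4) (indicatorPoint X) =
        (NonclassicalPolynomial.eighthElemSym n m).eval (indicatorPoint X) ↔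
      IsAgreementWeight (#X / 2 ^ m) := by
  rw [elemSym_indicatorPoint, NonclassicalPolynomial.eval_dyadicElemSym_indicatorPoint,
    toTorus_eq_toAddCircle, isAgreementWeight_div_two_pow_iff, ← toAddCircle_natCast_mul 4 2,
    ← ZMod.natCast_eq_natCast_iff]
  exact ZMod.toAddCircle_inj

theorem tendsto_agr_elemSym_eighthElemSym (m : ℕ) :
    Tendsto (fun n => agr (elemSym n (2 ^ m * 4)) (NonclassicalPolynomial.eighthElemSym n m).eval)
      atTop (𝓝 (9 / 16)) := by
  set f : ℕ → ℝ := fun w => if IsAgreementWeight (w / 2 ^ m) then 1 else 0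
  have hf : Function.Periodic f (2 ^ m * 16 : ℕ) := fun w => by
    simp only [f, Nat.add_mul_div_left w 16 (pow_pos two_pos m), isAgreementWeight_periodic _]
  have hagr (n : ℕ) : agr (elemSym n (2 ^ m * 4))
      (NonclassicalPolynomial.eighthElemSym n m).eval = binomialMean n f := by
    rw [agr_eq_expect_powerset _ _ (elemSym_eq_eighthElemSym_iff m),
      expect_powerset_apply_card univ f, card_fin]
  simp only [hagr]
  rw [← expect_isAgreementWeight m]
  exact tendsto_binomialMean_of_periodic hf fun w => by simp only [f]; split_ifs <;> simp

end NonclassicalAgreement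

theorem mainTheorem4 (ℓ : ℕ) (hℓ : 4 ≤ ℓ) :
    ∃ d : ℕ, 1 ≤ d ∧
      (∃ ε : ℕ → ℝ, Tendsto ε atTop (𝓝 0) ∧
        ∀ n : ℕ, 1 ≤ n → ∀ P : NonclassicalPolynomial n, P.IsClassical → P.degree ≤ d →
          agr (elemSym n (2 ^ ℓ)) P.eval ≤ 1 / 2 + ε n) ∧
      (∃ c : ℝ, 0 < c ∧ ∀ᶠ n : ℕ in atTop,
        ∃ P : NonclassicalPolynomial n, P.HasDyadicShift ∧ P.degree ≤ d ∧
          1 / 2 + c ≤ agr (elemSym n (2 ^ ℓ)) P.eval) := by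
  obtain ⟨m, rfl⟩ := Nat.exists_eq_add_of_le' (le_trans (by norm_num : 2 ≤ 4) hℓ)
  have hpow : 2 ^ (m + 2) = 2 ^ m * 4 := pow_add 2 m 2
  have hd : 2 ^ m * 3 + (3 - 1) < 2 ^ (m + 2) := by
    have : 2 ^ 2 ≤ 2 ^ m := Nat.pow_le_pow_right two_pos (by omega)
    omega
  refine ⟨2 ^ m * 3 + (3 - 1), by omega, ?_, 1 / 32, by norm_num, ?_⟩
  · obtain ⟨ε, hε, h⟩ := exists_tendsto_zero_forall_isClassical_agr_le hd
    exact ⟨ε, hε, fun n _ => h n⟩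
  · rw [hpow]
    have hlt : (1 / 2 + 1 / 32 : ℝ) < 9 / 16 := by norm_num
    filter_upwards [(tendsto_agr_elemSym_eighthElemSym m).eventually_const_le hlt] with n hn
    exact ⟨NonclassicalPolynomial.eighthElemSym n m,
      NonclassicalPolynomial.hasDyadicShift_dyadicElemSym _ _,
      NonclassicalPolynomial.degree_dyadicElemSym_le _ _, hn⟩
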